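/- Let $G$ be a (simple, undirected, not necessarily connected) graph that is locally finite (every vertex has finite degree), quasi-transitive (its automorphism group has only finitely many orbits on $V(G)$) and one-ended. Here a ray is a one-way infinite path, two rays are equivalent if for every finite $S\subseteq V(G)$ some component of $G-S$ contains all but finitely many vertices of both rays, the ends of $G$ are the equivalence classes of rays, and $G$ is one-ended if it has exactly one end. Let $G^2$ be the graph on $V(G)$ in which two vertices are adjacent if and only if their distance in $G$ is $1$ or $2$. Then $G^2$ is not minor excluded; that is, every finite graph $H$ is a minor of $G^2$: there are pairwise disjoint, nonempty, connected vertex sets $(B_x)_{x\in V(H)}$ of $G^2$ such that for every edge $xy$ of $H$ there is an edge of $G^2$ between $B_x$ and $B_y$. -/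

import Mathlib

namespace SimpleGraph

variable {V : Type*} {W : Type*}

/-- A ray of `G`: a one-way infinite path, given by the sequence of its vertices. -/
structure Ray (G : SimpleGraph V) where
  vert : ℕ → V
  injective_vert : Function.Injective vert
  adj_succ : ∀ n, G.Adj (vert n) (vert (n + 1))

/-- Two rays are equivalent if for every finite vertex set `S` some component of `G - S` contains
all but finitely many vertices of both rays. -/
def Ray.Equivalent {G : SimpleGraph V} (R R' : G.Ray) : Prop :=
  ∀ S : Set V, S.Finite → ∃ C : G.ComponentCompl S,
    (Set.range R.vert \ C.supp).Finite ∧ (Set.range R'.vert \ C.supp).Finite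

theorem Ray.Equivalent.refl {G : SimpleGraph V} (R : G.Ray) : R.Equivalent R := by
  intro S hS
  obtain ⟨N, hN⟩ := (hS.preimage R.injective_vert.injOn).bddAbove
  have h : ∀ k, R.vert (N + 1 + k) ∉ S := fun k hk => by
    have := hN (show N + 1 + k ∈ R.vert ⁻¹' S from hk)
    omega
  have key : ∀ k, R.vert (N + 1 + k) ∈ (G.componentComplMk (h 0)).supp := by
    intro k
    refine ⟨h k, ?_⟩
    induction k with
    | zero => rfl
    | succ k ih =>
      rw [← ih]
      exact (G.componentComplMk_eq_of_adj (h k) (h (k + 1)) (R.adj_succ _)).symm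
  have fin : (Set.range R.vert \ (G.componentComplMk (h 0)).supp).Finite := by
    refine ((Set.finite_Iio (N + 1)).image R.vert).subset ?_
    rintro _ ⟨⟨n, rfl⟩, hn⟩
    refine ⟨n, ?_, rfl⟩
    by_contra hlt
    obtain ⟨k, rfl⟩ := Nat.exists_eq_add_of_le (not_lt.mp hlt)
    exact hn (key k)
  exact ⟨_, fin, fin⟩

theorem Ray.Equivalent.trans {G : SimpleGraph V} {R₁ R₂ R₃ : G.Ray}
    (h₁ : R₁.Equivalent R₂) (h₂ : R₂.Equivalent R₃) : R₁.Equivalent R₃ := by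
  intro S hS
  obtain ⟨C, hC₁, hC₂⟩ := h₁ S hS
  obtain ⟨D, hD₂, hD₃⟩ := h₂ S hS
  obtain ⟨v, hv, hvn⟩ :=
    ((Set.infinite_range_of_injective R₂.injective_vert).sdiff (hC₂.union hD₂)).nonempty
  have hvC : v ∈ C := by
    by_contra hc
    exact hvn (Or.inl ⟨hv, hc⟩)
  have hvD : v ∈ D := by
    by_contra hd
    exact hvn (Or.inr ⟨hv, hd⟩)
  have hCD : C = D := by
    obtain ⟨_, e₁⟩ := hvC
    obtain ⟨_, e₂⟩ := hvD
    exact e₁.symm.trans e₂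
  subst hCD
  exact ⟨C, hC₁, hD₃⟩

/-- Equivalence of rays, as a setoid. -/
def raySetoid (G : SimpleGraph V) : Setoid G.Ray where
  r := Ray.Equivalent
  iseqv :=
    { refl := Ray.Equivalent.refl
      symm := fun h S hS => (h S hS).imp fun _ hC => ⟨hC.2, hC.1⟩
      trans := Ray.Equivalent.trans }

/-- The ends of `G`: the equivalence classes of rays. -/
def RayEnd (G : SimpleGraph V) : Type _ :=
  Quotient G.raySetoid

/-- `G` has exactly one end. -/
def IsOneEnded (G : SimpleGraph V) : Prop :=
  ∃ ω : G.RayEnd, ∀ ω' : G.RayEnd, ω' = ω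

/-- `G` is quasi-transitive: its automorphism group has only finitely many vertex orbits. -/
def IsQuasiTransitive (G : SimpleGraph V) : Prop :=
  Finite (MulAction.orbitRel.Quotient (G ≃g G) V)

/-- The square of `G`: distinct vertices are adjacent if their distance in `G` is `1` or `2`.
(`SimpleGraph.dist` is `0` for vertices in different components, so these are not adjacent.) -/
def square (G : SimpleGraph V) : SimpleGraph V where
  Adj u v := G.dist u v = 1 ∨ G.dist u v = 2
  symm := ⟨fun u v h => by rwa [G.dist_comm]⟩
  loopless := ⟨fun v h => by simp at h⟩

/-- `H` is a minor of `G`: there are pairwise disjoint (nonempty) connected branch sets in `G`,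
one for each vertex of `H`, with an edge of `G` between the branch sets of adjacent vertices. -/
def IsMinor (H : SimpleGraph W) (G : SimpleGraph V) : Prop :=
  ∃ B : W → Set V,
    (∀ x, (G.induce (B x)).Connected) ∧
    (∀ x y, x ≠ y → Disjoint (B x) (B y)) ∧
    ∀ x y, H.Adj x y → ∃ u ∈ B x, ∃ v ∈ B y, G.Adj u v

/-- `G` is minor excluded: some finite graph is not a minor of it. -/
def IsMinorExcluded (G : SimpleGraph V) : Prop :=
  ∃ (W : Type) (_ : Finite W) (H : SimpleGraph W), ¬ H.IsMinor G

end SimpleGraph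

/-!
The end of a one-ended, locally finite, quasi-transitive graph `G` is thick: `G` contains any finite
number of disjoint rays, which are then pairwise equivalent. In the square of `G`, such rays can be
crossed, and this yields all finite minors.

*Thickness.* By quasi-transitivity there are radii `r 0 < r 1 < …`, independent of the centre, such
that around every vertex the annulus between two consecutive radii is connected, apart from parts
that do not extend through it; this is one-endedness made uniform
(`IsQuasiTransitive.eventually_isConnectedAnnulus`). Suppose that a set `S` of fewer than `n`
vertices cuts off a vertex `u` far from `S` from infinity. Then some vertex `s` of `S` borders both
the finite component `K` of `u` and an infinite component of `G - K`. One of `n` annuli around `s`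
misses `S` and is crossed by both of them, so they are connected in `G - S`, a contradiction
(`infinite_of_far`). So if a finite set `F` has too many vertices to be covered by `n` balls of
radius `r n`, fewer than `n` vertices never separate it from infinity. Menger's theorem
(`Relation.menger`, by Göring's induction on the number of arcs) gives `n` disjoint paths of any
given length starting in `F`, and compactness gives `n` disjoint rays
(`IsQuasiTransitive.exists_isRayFamily`).

*Crossing.* Take disjoint, equivalent rays, and delete from each of them pairwise non-consecutive
vertices; in the square each ray stays connected. On the other hand, every second vertex of each
ray, together with the vertices off the rays, suffices to connect all the rays with each other,
provided that the parities are chosen well (`IsAlternateConnected.exists_insert`). A finite part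
of this connection is a connected set that meets every ray, never in two consecutive vertices
(`IsRayFamily.exists_connector`), and repeating the construction further out gives infinitely many
such connectors. A ray minus all connectors, together with a connector of its own, is a branch set,
and any two of these branch sets are adjacent (`IsRayFamily.isMinor_square`).
-/

/-! ### Walks inside a set -/

namespace Relation

variable {V : Type*} {r r' : V → V → Prop} {T T' S : Set V} {a b c : V}

/-- `ReachIn r T a b`: there is a directed `r`-walk from `a` to `b` all of whose vertices, the two
ends included, lie in `T`. -/
def ReachIn (r : V → V → Prop) (T : Set V) (a b : V) : Prop :=
  a ∈ T ∧ ReflTransGen (fun u v => r u v ∧ v ∈ T) a b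

namespace ReachIn

theorem refl (h : a ∈ T) : ReachIn r T a a := ⟨h, .refl⟩

theorem left_mem (h : ReachIn r T a b) : a ∈ T := h.1

theorem tail (h : ReachIn r T a b) (hr : r b c) (hc : c ∈ T) : ReachIn r T a c :=
  ⟨h.1, h.2.tail ⟨hr, hc⟩⟩

theorem right_mem (h : ReachIn r T a b) : b ∈ T := by
  obtain ⟨ha, h⟩ := h
  induction h with
  | refl => exact ha
  | tail _ h _ => exact h.2

theorem trans (h : ReachIn r T a b) (h' : ReachIn r T b c) : ReachIn r T a c :=
  ⟨h.1, h.2.trans h'.2⟩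

theorem head (ha : a ∈ T) (hr : r a b) (h : ReachIn r T b c) : ReachIn r T a c :=
  ((refl ha).tail hr h.left_mem).trans h

@[elab_as_elim]
theorem tail_induction {P : V → Prop} (h : ReachIn r T a b) (base : P a)
    (step : ∀ u v, ReachIn r T a u → r u v → v ∈ T → P u → P v) : P b := by
  obtain ⟨ha, h⟩ := h
  induction h with
  | refl => exact base
  | tail h' h ih => exact step _ _ ⟨ha, h'⟩ h.1 h.2 ih

theorem mono_rel (hr : ∀ u v, r u v → r' u v) (hT : T ⊆ T') (h : ReachIn r T a b) :
    ReachIn r' T' a b :=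
  ⟨hT h.1, ReflTransGen.mono (fun _ _ h => ⟨hr _ _ h.1, hT h.2⟩) _ _ h.2⟩

theorem mono (hT : T ⊆ T') (h : ReachIn r T a b) : ReachIn r T' a b :=
  h.mono_rel (fun _ _ => id) hT

theorem swap (h : ReachIn r T a b) : ReachIn (Function.swap r) T b a := by
  refine h.tail_induction (refl h.left_mem) fun u v hu huv hv ih => ?_
  exact head hv huv ih

theorem symm (hr : ∀ u v, r u v → r v u) (h : ReachIn r T a b) : ReachIn r T b a :=
  h.swap.mono_rel (fun u v => hr v u) subset_rfl

@[elab_as_elim]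
theorem head_induction {P : V → Prop} (h : ReachIn r T a b) (base : P b)
    (step : ∀ u v, u ∈ T → r u v → ReachIn r T v b → P v → P u) : P a :=
  h.swap.tail_induction base fun u v hu huv hv ih => step v u hv huv hu.swap ih

theorem exists_first_exit (h : ReachIn r T a b) (ha : a ∈ S) (hb : b ∉ S) :
    ∃ u v, ReachIn r (T ∩ S) a u ∧ r u v ∧ v ∈ T ∧ v ∉ S := by
  have : (ReachIn r (T ∩ S) a b) ∨ ∃ u v, ReachIn r (T ∩ S) a u ∧ r u v ∧ v ∈ T ∧ v ∉ S := by
    refine h.tail_induction (Or.inl (refl ⟨h.left_mem, ha⟩)) fun u v _ huv hv ih => ?_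
    rcases ih with ih | ih
    · by_cases hvS : v ∈ S
      · exact Or.inl (ih.tail huv ⟨hv, hvS⟩)
      · exact Or.inr ⟨u, v, ih, huv, hv, hvS⟩
    · exact Or.inr ih
  exact this.resolve_left fun h' => hb h'.right_mem.2

theorem exists_last_exit (h : ReachIn r T a b) (ha : a ∈ S) (hb : b ∉ S) :
    ∃ u v, u ∈ T ∧ u ∈ S ∧ r u v ∧ ReachIn r (T \ S) v b := by
  obtain ⟨v, u, hv, hr, hu, huS⟩ := h.swap.exists_first_exit (S := Sᶜ) hb (fun h => h ha)
  exact ⟨u, v, hu, not_not.mp huS, hr, hv.swap⟩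

theorem diff_or_exists_mem (h : ReachIn r T a b) (S : Set V) :
    ReachIn r (T \ S) a b ∨ ∃ s ∈ S, ReachIn r T a s ∧ ReachIn r T s b := by
  refine h.tail_induction ?_ fun u v hu huv hv ih => ?_
  · by_cases ha : a ∈ S
    · exact Or.inr ⟨a, ha, refl h.left_mem, refl h.left_mem⟩
    · exact Or.inl (refl ⟨h.left_mem, ha⟩)
  · rcases ih with ih | ⟨s, hs, has, hsu⟩
    · by_cases hvS : v ∈ S
      · exact Or.inr ⟨v, hvS, hu.tail huv hv, refl hv⟩
      · exact Or.inl (ih.tail huv ⟨hv, hvS⟩)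
    · exact Or.inr ⟨s, hs, has, hsu.tail huv hv⟩

/-- A walk is finite: it stays in a finite subset of `T`, all of which is reachable. -/
theorem exists_finite (h : ReachIn r T a b) :
    ∃ Q ⊆ T, Q.Finite ∧ ReachIn r Q a b ∧ ∀ v ∈ Q, ReachIn r Q a v := by
  refine h.tail_induction ⟨{a}, by simpa using h.left_mem, Set.finite_singleton a,
    refl rfl, by rintro v rfl; exact refl rfl⟩ ?_
  rintro u v _ huv hv ⟨Q, hQT, hQ, hu, hall⟩
  have hv' : ReachIn r (insert v Q) a v :=
    (hu.mono (Set.subset_insert v Q)).tail huv (Set.mem_insert v Q)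
  refine ⟨insert v Q, Set.insert_subset hv hQT, hQ.insert v, hv', ?_⟩
  rintro w (rfl | hw)
  · exact hv'
  · exact (hall w hw).mono (Set.subset_insert v Q)

end ReachIn

end Relation

/-! ### Menger's theorem -/

namespace Relation

open ReachIn

variable {V : Type*} {r : V → V → Prop}

/-- `S` separates `A` from `B`: every directed `r`-walk from `A` to `B` meets `S`. -/
def Separates (r : V → V → Prop) (A B S : Set V) : Prop :=
  ∀ a ∈ A, ∀ b ∈ B, ¬ ReachIn r Sᶜ a b

/-- `A` and `B` are joined by `k` disjoint walks. Each walk is recorded only through a set `P i`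
inside which it runs. -/
def Linked (r : V → V → Prop) (A B : Set V) (k : ℕ) : Prop :=
  ∃ P : Fin k → Set V, (∀ i j, i ≠ j → Disjoint (P i) (P j)) ∧
    ∀ i, ∃ a ∈ A, ∃ b ∈ B, ReachIn r (P i) a b

theorem Linked.mono {r' : V → V → Prop} {A B : Set V} {k : ℕ} (hr : ∀ u v, r u v → r' u v)
    (h : Linked r A B k) : Linked r' A B k := by
  obtain ⟨P, hP, h⟩ := h
  refine ⟨P, hP, fun i => ?_⟩
  obtain ⟨a, ha, b, hb, hab⟩ := h i
  exact ⟨a, ha, b, hb, hab.mono_rel hr subset_rfl⟩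

/-- If the walk meets `S` at most in its last vertex, its carrier can be trimmed so that everything
outside `S` is reached without using `S`. -/
theorem ReachIn.trim {P S : Set V} {a b : V} (h : ReachIn r P a b) (hS : P ∩ S ⊆ {b}) :
    ∃ P' ⊆ P, ReachIn r P' a b ∧ ∀ v ∈ P', v ∉ S → ReachIn r Sᶜ a v := by
  set P' : Set V := {v ∈ P | v ∈ S ∨ ReachIn r (P \ S) a v} with hP'
  refine ⟨P', fun v hv => hv.1, ?_, ?_⟩
  · have ha : a ∈ P' := by
      refine ⟨h.left_mem, ?_⟩
      by_cases haS : a ∈ S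
      · exact Or.inl haS
      · exact Or.inr (refl ⟨h.left_mem, haS⟩)
    have : ReachIn r P' a b ∨ ReachIn r P' a b := by
      refine h.tail_induction (P := fun v => ReachIn r P' a v ∨ ReachIn r P' a b)
        (Or.inl (refl ha)) ?_
      rintro u v - huv hv (hu | hb)
      · by_cases huS : u ∈ S
        · obtain rfl : u = b := hS ⟨hu.right_mem.1, huS⟩
          exact Or.inr hu
        · refine Or.inl (hu.tail huv ⟨hv, ?_⟩)
          by_cases hvS : v ∈ S
          · exact Or.inl hvS
          · exact Or.inr ((hu.right_mem.2.resolve_left huS).tail huv ⟨hv, hvS⟩)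
      · exact Or.inr hb
    exact this.elim id id
  · rintro v ⟨-, hv⟩ hvS
    exact (hv.resolve_left hvS).mono fun w hw => hw.2

/-- `k` disjoint walks ending in a set `X` of `k` vertices end in distinct vertices of `X` and meet
`X` nowhere else; so they can be indexed by `X` and trimmed with respect to any `S ⊆ X`. -/
theorem Linked.trim {A : Set V} {X : Finset V} {S : Set V} (hSX : S ⊆ X)
    (h : Linked r A X X.card) :
    ∃ P : X → Set V, (∀ i j, i ≠ j → Disjoint (P i) (P j)) ∧
      ∀ x : X, P x ∩ S ⊆ {x.1} ∧ ∃ a ∈ A, ReachIn r (P x) a x ∧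
        ∀ v ∈ P x, v ∉ S → ReachIn r Sᶜ a v := by
  obtain ⟨P, hP, h⟩ := h
  choose a ha b hb hab using h
  have hinj : Function.Injective (fun i => (⟨b i, hb i⟩ : X)) := by
    intro i j hij
    by_contra hne
    have : b i = b j := congrArg Subtype.val hij
    exact Set.disjoint_left.mp (hP i j hne) (hab i).right_mem (this ▸ (hab j).right_mem)
  have hbij : Function.Bijective (fun i => (⟨b i, hb i⟩ : X)) :=
    (Fintype.bijective_iff_injective_and_card _).mpr ⟨hinj, by simp⟩
  set e := Equiv.ofBijective _ hbij with he
  have hbe : ∀ x : X, b (e.symm x) = x := fun x => congrArg Subtype.val (e.apply_symm_apply x)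
  have hmeet : ∀ x : X, P (e.symm x) ∩ S ⊆ {x.1} := by
    rintro x v ⟨hv, hvS⟩
    by_contra hne
    have h1 : v ∈ P (e.symm ⟨v, hSX hvS⟩) := by
      have := (hab (e.symm ⟨v, hSX hvS⟩)).right_mem
      rwa [hbe] at this
    have h2 : e.symm x ≠ e.symm ⟨v, hSX hvS⟩ := by
      intro h
      exact hne (congrArg Subtype.val (e.symm.injective h)).symm
    exact Set.disjoint_left.mp (hP _ _ h2) hv h1
  have key : ∀ x : X, ∃ P' ⊆ P (e.symm x), ReachIn r P' (a (e.symm x)) x ∧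
      ∀ v ∈ P', v ∉ S → ReachIn r Sᶜ (a (e.symm x)) v := by
    intro x
    have := hab (e.symm x)
    rw [hbe] at this
    exact this.trim (hmeet x)
  choose P' hP' hr htr using key
  refine ⟨P', fun i j hij => (hP _ _ (e.symm.injective.ne hij)).mono (hP' i) (hP' j), fun x =>
    ⟨fun v hv => hmeet x ⟨hP' x hv.1, hv.2⟩, _, ha (e.symm x), hr x, htr x⟩⟩

theorem Linked.swap {A B : Set V} {k : ℕ} (h : Linked r A B k) :
    Linked (Function.swap r) B A k := by
  obtain ⟨P, hP, h⟩ := h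
  refine ⟨P, hP, fun i => ?_⟩
  obtain ⟨a, ha, b, hb, hab⟩ := h i
  exact ⟨b, hb, a, ha, hab.swap⟩

/-- The inductive step of Göring's proof of Menger's theorem. The set `S` separates `A` from `B`
once the arc `x → y` is deleted; walks from `A` to `S ∪ {x}` and walks from `S ∪ {y}` to `B` are
glued along `S` and along `x → y`. -/
theorem linked_of_linked_of_linked {r' : V → V → Prop} [DecidableEq V] {A B : Set V} {S : Finset V}
    {x y : V} (hr : ∀ u v, r u v → r' u v) (hxy : r' x y) (hx : x ∉ S) (hy : y ∉ S)
    (hS : Separates r A B S)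
    (h₁ : Linked r A (insert x S : Finset V) (insert x S).card)
    (h₂ : Linked r (insert y S : Finset V) B (insert y S).card) :
    Linked r' A B (S.card + 1) := by
  obtain ⟨P, hP, hPa⟩ := h₁.trim (S := S) (by simp)
  obtain ⟨Q, hQ, hQb⟩ := h₂.swap.trim (S := S) (by simp)
  -- the walk ending in `z` is continued by the walk that starts in `z`, or in `y` if `z = x`
  let σ : ↥(insert x S) → ↥(insert y S) := fun z =>
    if h : z.1 ∈ S then ⟨z, Finset.mem_insert_of_mem h⟩ else ⟨y, Finset.mem_insert_self _ _⟩
  have hσ_mem : ∀ z, z.1 ∈ S → (σ z).1 = z := fun z hz => by simp [σ, hz]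
  have hσ_not : ∀ z, z.1 ∉ S → (σ z).1 = y ∧ z.1 = x := fun z hz =>
    ⟨by simp [σ, hz], (Finset.mem_insert.mp z.2).resolve_right hz⟩
  have hσ : Function.Injective σ := by
    intro z w hzw
    have hzw' : (σ z).1 = (σ w).1 := congrArg Subtype.val hzw
    apply Subtype.ext
    by_cases hz : z.1 ∈ S <;> by_cases hw : w.1 ∈ S
    · rwa [hσ_mem z hz, hσ_mem w hw] at hzw'
    · rw [hσ_mem z hz, (hσ_not w hw).1] at hzw'
      exact absurd (hzw' ▸ hz) hy
    · rw [hσ_mem w hw, (hσ_not z hz).1] at hzw'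
      exact absurd (hzw' ▸ hw) hy
    · rw [(hσ_not z hz).2, (hσ_not w hw).2]
  have hPQ : ∀ z w, ∀ v ∈ P z, v ∈ Q w → v = z.1 ∧ v = w.1 ∧ v ∈ S := by
    intro z w v hv hw
    obtain ⟨hz1, a, ha, -, haz⟩ := hPa z
    obtain ⟨hw1, b, hb, -, hbw⟩ := hQb w
    by_cases hvS : v ∈ S
    · exact ⟨hz1 ⟨hv, hvS⟩, hw1 ⟨hw, hvS⟩, hvS⟩
    · exact absurd ((haz v hv hvS).trans (hbw v hw hvS).swap) (hS a ha b hb)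
  have hdisj : ∀ z w, z ≠ w → Disjoint (P z) (Q (σ w)) := by
    intro z w hzw
    refine Set.disjoint_left.mpr fun v hv hv' => hzw (Subtype.ext ?_)
    obtain ⟨e1, e2, hvS⟩ := hPQ z (σ w) v hv hv'
    by_cases hw : w.1 ∈ S
    · rw [← e1, e2, hσ_mem w hw]
    · rw [(hσ_not w hw).1] at e2
      exact absurd (e2 ▸ hvS) hy
  have hcard : Fintype.card ↥(insert x S) = S.card + 1 := by
    rw [Fintype.card_coe, Finset.card_insert_of_notMem hx]
  let e : Fin (S.card + 1) ≃ ↥(insert x S) := (Fintype.equivFinOfCardEq hcard).symm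
  refine ⟨fun i => P (e i) ∪ Q (σ (e i)), fun i j hij => ?_, fun i => ?_⟩
  · have hne := e.injective.ne hij
    rw [Set.disjoint_union_left, Set.disjoint_union_right, Set.disjoint_union_right]
    exact ⟨⟨hP _ _ hne, hdisj _ _ hne⟩, (hdisj _ _ hne.symm).symm, hQ _ _ (hσ.ne hne)⟩
  · obtain ⟨-, a, ha, haz, -⟩ := hPa (e i)
    obtain ⟨-, b, hb, hbz, -⟩ := hQb (σ (e i))
    refine ⟨a, ha, b, hb, ?_⟩
    have h1 : ReachIn r' (P (e i) ∪ Q (σ (e i))) a (e i) :=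
      haz.mono_rel hr Set.subset_union_left
    have h2 : ReachIn r' (P (e i) ∪ Q (σ (e i))) (σ (e i)) b :=
      hbz.swap.mono_rel hr Set.subset_union_right
    by_cases hz : (e i).1 ∈ S
    · rw [hσ_mem _ hz] at h2
      exact h1.trans h2
    · rw [(hσ_not _ hz).1] at h2
      rw [(hσ_not _ hz).2] at h1
      exact h1.trans (head h1.right_mem hxy h2)

/-- **Menger's theorem** for a relation with finitely many arcs. -/
theorem menger (E : Finset (V × V)) (k : ℕ) (A : Finset V) (B : Set V)
    (h : ∀ S : Finset V, Separates (fun u v => (u, v) ∈ E) A B S → k ≤ S.card) :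
    Linked (fun u v => (u, v) ∈ E) A B k := by
  classical
  induction E using Finset.induction_on generalizing k A B with
  | empty =>
    have hk : k ≤ (A.filter (· ∈ B)).card := by
      refine h _ fun a ha b hb hab => ?_
      have : a = b := hab.tail_induction (P := fun v => a = v) rfl fun u v _ huv => by simp at huv
      subst this
      exact hab.left_mem (by simpa using ⟨ha, hb⟩)
    obtain ⟨C, hC, rfl⟩ := Finset.exists_subset_card_eq hk
    refine ⟨fun i => {(C.equivFin.symm i).1}, fun i j hij => ?_, fun i => ?_⟩
    · simpa [Subtype.ext_iff] using fun h => hij (C.equivFin.symm.injective (Subtype.ext h))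
    · have := Finset.mem_filter.mp (hC (C.equivFin.symm i).2)
      exact ⟨_, this.1, _, this.2, refl rfl⟩
  | insert e E _ ih =>
    obtain ⟨x, y⟩ := e
    have hmono : ∀ u v, (u, v) ∈ E → (u, v) ∈ insert (x, y) E :=
      fun u v => Finset.mem_insert_of_mem
    -- a walk in `T` either avoids the new arc or contains old walks in `T` to `x` and from `y`
    have hsplit : ∀ (T : Set V) (a b : V), ReachIn (fun u v => (u, v) ∈ insert (x, y) E) T a b →
        ReachIn (fun u v => (u, v) ∈ E) T a b ∨
          (ReachIn (fun u v => (u, v) ∈ E) T a x ∧ ReachIn (fun u v => (u, v) ∈ E) T y b) := by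
      intro T a b hab
      refine hab.tail_induction (Or.inl (refl hab.left_mem)) fun u v _ huv hv ih => ?_
      rcases Finset.mem_insert.mp huv with heq | huv
      · obtain ⟨rfl, rfl⟩ := Prod.mk.inj heq
        exact Or.inr ⟨ih.elim id And.left, refl hv⟩
      · exact ih.imp (·.tail huv hv) fun h => ⟨h.1, h.2.tail huv hv⟩
    by_cases hsep : ∀ S : Finset V, Separates (fun u v => (u, v) ∈ E) A B S → k ≤ S.card
    · exact (ih k A B hsep).mono hmono
    push Not at hsep
    obtain ⟨S, hS, hSk⟩ := hsep
    have hnot : ¬ Separates (fun u v => (u, v) ∈ insert (x, y) E) A B S :=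
      fun h' => absurd (h S h') (by omega)
    simp only [Separates, not_forall, not_not] at hnot
    obtain ⟨a, ha, b, hb, hab⟩ := hnot
    obtain ⟨hax, hyb⟩ := (hsplit _ a b hab).resolve_left (hS a ha b hb)
    have hx : x ∉ S := hax.right_mem
    have hy : y ∉ S := hyb.left_mem
    -- a walk from `A` to `B` that avoids the new arc meets `S`, which splits it into two
    have hthrough : ∀ (T : Set V), ∀ a ∈ A, ∀ b ∈ B, ReachIn (fun u v => (u, v) ∈ E) T a b →
        ∃ s ∈ S, ReachIn (fun u v => (u, v) ∈ E) T a s ∧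
          ReachIn (fun u v => (u, v) ∈ E) T s b := by
      intro T a ha b hb hab
      exact (hab.diff_or_exists_mem S).resolve_left fun h' =>
        hS a ha b hb (h'.mono fun v hv => hv.2)
    have hk1 : k ≤ S.card + 1 := by
      have : Separates (fun u v => (u, v) ∈ insert (x, y) E) A B (insert x S : Finset V) := by
        intro a ha b hb hab
        have hsub : ((insert x S : Finset V) : Set V)ᶜ ⊆ (S : Set V)ᶜ :=
          Set.compl_subset_compl.mpr (by simp)
        rcases hsplit _ a b hab with h' | h'
        · exact hS a ha b hb (h'.mono hsub)
        · exact h'.1.right_mem (by simp)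
      simpa [hx] using h _ this
    obtain rfl : k = S.card + 1 := by omega
    have hcx : (insert x S).card = S.card + 1 := Finset.card_insert_of_notMem hx
    have hcy : (insert y S).card = S.card + 1 := Finset.card_insert_of_notMem hy
    refine linked_of_linked_of_linked hmono (Finset.mem_insert_self _ _) hx hy hS
      (ih _ A _ fun T hT => hcx ▸ h T fun a ha b hb hab => ?_)
      (ih _ _ B fun T hT => hcy ▸ h T fun a ha b hb hab => ?_)
    · rcases hsplit _ a b hab with h' | h'
      · obtain ⟨s, hs, has, -⟩ := hthrough _ a ha b hb h'
        exact hT a ha s (by simp [hs]) has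
      · exact hT a ha x (by simp) h'.1
    · rcases hsplit _ a b hab with h' | h'
      · obtain ⟨s, hs, -, hsb⟩ := hthrough _ a ha b hb h'
        exact hT s (by simp [hs]) b hb hsb
      · exact hT y (by simp) b hb h'.2

end Relation

/-! ### Minors of the square from disjoint equivalent rays -/

namespace SimpleGraph

open Relation Relation.ReachIn

variable {V : Type*} {G : SimpleGraph V}

theorem square_adj_of_adj {u v : V} (h : G.Adj u v) : G.square.Adj u v :=
  Or.inl (dist_eq_one_iff_adj.mpr h)

theorem square_adj_of_adj_of_adj {u v w : V} (h : G.Adj u v) (h' : G.Adj v w) (hne : u ≠ w) :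
    G.square.Adj u w := by
  have hle : G.dist u w ≤ 2 := dist_le (.cons h (.cons h' .nil))
  have hpos : 0 < G.dist u w := (Reachable.pos_dist_of_ne ⟨.cons h (.cons h' .nil)⟩ hne)
  change G.dist u w = 1 ∨ G.dist u w = 2
  omega

/-- A family of pairwise disjoint rays of `G`, given as sequences of vertices. -/
structure IsRayFamily (G : SimpleGraph V) {ι : Type*} (f : ι → ℕ → V) : Prop where
  inj : ∀ {c d i j}, f c i = f d j → c = d ∧ i = j
  adj : ∀ c i, G.Adj (f c i) (f c (i + 1))

/-- Any two members of `f` have, arbitrarily far out, vertices that remain connected after the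
deletion of any given finite set. -/
def IsEquivalentFamily (G : SimpleGraph V) {ι : Type*} (f : ι → ℕ → V) : Prop :=
  ∀ Z : Set V, Z.Finite → ∀ c d m, ∃ i ≥ m, ∃ j ≥ m, ReachIn G.Adj Zᶜ (f c i) (f d j)

variable {ι : Type*} {f : ι → ℕ → V}

theorem IsRayFamily.finite_setOf_mem (hf : G.IsRayFamily f) {Z : Set V} (hZ : Z.Finite) :
    {q : ι × ℕ | f q.1 q.2 ∈ Z}.Finite :=
  hZ.preimage fun _ _ _ _ h => Prod.ext_iff.mpr (hf.inj h)

theorem IsRayFamily.exists_forall_ge_notMem (hf : G.IsRayFamily f) {Z : Set V} (hZ : Z.Finite) :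
    ∃ m, ∀ c, ∀ i ≥ m, f c i ∉ Z := by
  obtain ⟨m, hm⟩ := ((hf.finite_setOf_mem hZ).image Prod.snd).bddAbove
  refine ⟨m + 1, fun c i hi h => ?_⟩
  have := hm ⟨(c, i), h, rfl⟩
  dsimp only at this
  omega

theorem IsRayFamily.square_adj (hf : G.IsRayFamily f) (c : ι) (i : ℕ) :
    G.square.Adj (f c i) (f c (i + 2)) :=
  square_adj_of_adj_of_adj (hf.adj c i) (hf.adj c (i + 1)) fun h => by
    have := (hf.inj h).2
    omega

/-- Beyond the `m`-th vertex, the vertices of the rays `f c`, `c ∈ I`, whose index has the parity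
of `p c`. -/
def alternate (f : ι → ℕ → V) (m : ℕ) (I : Set ι) (p : ι → ℕ) : Set V :=
  {v | ∃ c ∈ I, ∃ i ≥ m, Even (i + p c) ∧ v = f c i}

theorem IsRayFamily.reachIn_alternate (hf : G.IsRayFamily f) {m : ℕ} {p : ι → ℕ} {U : Set V}
    {c : ι} (hU : alternate f m {c} p ⊆ U) {i j : ℕ} (hi : m ≤ i) (hj : m ≤ j)
    (hie : Even (i + p c)) (hje : Even (j + p c)) :
    ReachIn G.square.Adj U (f c i) (f c j) := by
  wlog hij : i ≤ j generalizing i j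
  · exact (this hj hi hje hie (by omega)).symm fun _ _ => Adj.symm
  obtain ⟨k, rfl⟩ : ∃ k, j = i + 2 * k := by
    obtain ⟨a, ha⟩ := hie
    obtain ⟨b, hb⟩ := hje
    exact ⟨b - a, by omega⟩
  have hmem : ∀ k, f c (i + 2 * k) ∈ U := fun k =>
    hU ⟨c, rfl, i + 2 * k, by omega, by grind, rfl⟩
  clear hje hj hij
  induction k with
  | zero => exact refl (hmem 0)
  | succ k ih => exact ih.tail (hf.square_adj c _) (hmem (k + 1))

/-- The vertices outside `Z` and off all the rays `f c`. -/
def offRays (f : ι → ℕ → V) (Z : Set V) : Set V :=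
  {v | v ∉ Z ∧ ∀ c i, v ≠ f c i}

/-- The parities `p` select alternating vertices of the rays `f c`, `c ∈ I`, all of which lie in one
component of the square of `G`, restricted to these vertices and those off the rays. -/
def IsAlternateConnected (G : SimpleGraph V) (f : ι → ℕ → V) (Z : Set V) (m : ℕ) (I : Set ι)
    (p : ι → ℕ) : Prop :=
  ∀ u ∈ alternate f m I p, ∀ v ∈ alternate f m I p,
    ReachIn G.square.Adj (offRays f Z ∪ alternate f m I p) u v

theorem IsRayFamily.isAlternateConnected_singleton (hf : G.IsRayFamily f) (Z : Set V) (m : ℕ)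
    (c : ι) (p : ι → ℕ) : G.IsAlternateConnected f Z m {c} p := by
  rintro _ ⟨c, rfl, i, hi, hie, rfl⟩ _ ⟨_, rfl, j, hj, hje, rfl⟩
  exact hf.reachIn_alternate Set.subset_union_right hi hj hie hje

/-- A further ray can be attached by following a walk of `G - Z` from the old rays to the new ones.
The walk first meets the new rays in a vertex `f d j`, and the parity for `d` is chosen to select
`f d j`. Where the walk leaves an old ray in a vertex that was not selected, the successor of that
vertex on the ray was, and it is within distance two of the next vertex of the walk. -/
theorem IsAlternateConnected.exists_insert {Z : Set V} {m : ℕ} {I : Set ι} {p : ι → ℕ}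
    (h : G.IsAlternateConnected f Z m I p) (hf : G.IsRayFamily f) (hl : G.IsEquivalentFamily f)
    (hZ : Z.Finite) [Finite ι] {c₀ d₀ : ι} (hc₀ : c₀ ∈ I) (hd₀ : d₀ ∉ I) :
    ∃ d ∉ I, ∃ p', G.IsAlternateConnected f Z m (insert d I) p' := by
  classical
  set U := offRays f Z ∪ alternate f m I p with hU
  obtain ⟨i₀, hi₀, he₀⟩ : ∃ i₀ ≥ m, Even (i₀ + p c₀) := by
    rcases Nat.even_or_odd (m + p c₀) with he | he
    · exact ⟨m, le_rfl, he⟩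
    · exact ⟨m + 1, by omega, by grind⟩
  have ha₀ : f c₀ i₀ ∈ alternate f m I p := ⟨c₀, hc₀, i₀, hi₀, he₀, rfl⟩
  set S : Set V := {v | ∃ c ∈ I, ∃ i ≥ m, v = f c i} ∪
    {v ∈ offRays f Z | ReachIn G.square.Adj U (f c₀ i₀) v} with hS
  set Z' : Set V := Z ∪ (fun q : ι × ℕ => f q.1 q.2) '' (Set.univ ×ˢ Set.Iio m) with hZ'
  have hZ'_fin : Z'.Finite := hZ.union ((Set.finite_univ.prod (Set.finite_Iio m)).image _)
  obtain ⟨i, hi, j, hj, hij⟩ := hl Z' hZ'_fin c₀ d₀ m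
  obtain ⟨v, w, hv, hvw, hw, hwS⟩ := hij.exists_first_exit (S := S)
    (Or.inl ⟨c₀, hc₀, i, hi, rfl⟩) (by
      rintro (⟨c, hc, k, -, hk⟩ | ⟨h, -⟩)
      · exact hd₀ ((hf.inj hk).1 ▸ hc)
      · exact h.2 d₀ j rfl)
  -- `w` is within distance two of a vertex of `U` in the component under construction
  obtain ⟨a, ha, haw⟩ : ∃ a, ReachIn G.square.Adj U (f c₀ i₀) a ∧ G.square.Adj a w := by
    rcases hv.right_mem.2 with ⟨c, hc, k, hk, rfl⟩ | ⟨-, hv⟩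
    · rcases Nat.even_or_odd (k + p c) with he | he
      · exact ⟨f c k, h _ ha₀ _ ⟨c, hc, k, hk, he, rfl⟩, square_adj_of_adj hvw⟩
      · refine ⟨f c (k + 1), h _ ha₀ _ ⟨c, hc, k + 1, by omega, by grind, rfl⟩,
          square_adj_of_adj_of_adj (hf.adj c k).symm hvw ?_⟩
        rintro rfl
        exact hwS (Or.inl ⟨c, hc, k + 1, by omega, rfl⟩)
    · exact ⟨v, hv, square_adj_of_adj hvw⟩
  have hw_off : w ∉ offRays f Z := fun hwO => hwS (Or.inr ⟨hwO, ha.tail haw (Or.inl hwO)⟩)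
  obtain ⟨d, j, rfl⟩ : ∃ d j, w = f d j := by
    by_contra hcon
    push Not at hcon
    exact hw_off ⟨fun hwZ => hw (Or.inl hwZ), hcon⟩
  have hj : m ≤ j := by
    by_contra hlt
    exact hw (Or.inr ⟨(d, j), ⟨trivial, by simpa using hlt⟩, rfl⟩)
  have hd : d ∉ I := fun hd => hwS (Or.inl ⟨d, hd, j, hj, rfl⟩)
  refine ⟨d, hd, Function.update p d j, ?_⟩
  set U' := offRays f Z ∪ alternate f m (insert d I) (Function.update p d j) with hU'
  have hp : ∀ c ∈ I, Function.update p d j c = p c := fun c hc =>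
    Function.update_of_ne (by rintro rfl; exact hd hc) _ _
  have hUU' : U ⊆ U' := by
    refine Set.union_subset_union_right _ ?_
    rintro _ ⟨c, hc, k, hk, hke, rfl⟩
    exact ⟨c, Or.inr hc, k, hk, by rwa [hp c hc], rfl⟩
  have hdU' : alternate f m {d} (Function.update p d j) ⊆ U' := by
    rintro _ ⟨c, rfl, k, hk, hke, rfl⟩
    exact Or.inr ⟨c, Or.inl rfl, k, hk, hke, rfl⟩
  have hje : Even (j + Function.update p d j d) := by simp
  have key : ∀ u ∈ alternate f m (insert d I) (Function.update p d j),
      ReachIn G.square.Adj U' (f c₀ i₀) u := by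
    rintro _ ⟨c, hc | hc, k, hk, hke, rfl⟩
    · subst hc
      exact ((ha.mono hUU').tail haw (hdU' ⟨c, rfl, j, hj, hje, rfl⟩)).trans
        (hf.reachIn_alternate hdU' hj hk hje hke)
    · rw [hp c hc] at hke
      exact (h _ ha₀ _ ⟨c, hc, k, hk, hke, rfl⟩).mono hUU'
  exact fun u hu v hv => ((key u hu).symm fun _ _ => Adj.symm).trans (key v hv)

theorem IsRayFamily.exists_isAlternateConnected_univ [Finite ι] [Nonempty ι] (hf : G.IsRayFamily f)
    (hl : G.IsEquivalentFamily f) {Z : Set V} (hZ : Z.Finite) (m : ℕ) :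
    ∃ p, G.IsAlternateConnected f Z m Set.univ p := by
  obtain ⟨c₀⟩ := ‹Nonempty ι›
  obtain ⟨I, ⟨hI, p, hp⟩, hmax⟩ := (Set.toFinite
    {I : Set ι | c₀ ∈ I ∧ ∃ p, G.IsAlternateConnected f Z m I p}).exists_maximal
      ⟨{c₀}, rfl, 0, hf.isAlternateConnected_singleton Z m c₀ 0⟩
  obtain rfl : I = Set.univ := by
    refine Set.eq_univ_of_forall fun d₀ => ?_
    by_contra hd₀
    obtain ⟨d, hd, p', hp'⟩ := hp.exists_insert hf hl hZ hI hd₀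
    exact hd (hmax ⟨Or.inr hI, p', hp'⟩ (Set.subset_insert d I) (Set.mem_insert d I))
  exact ⟨p, hp⟩

/-- Avoiding any finite set, there is a finite connected set of the square of `G` that meets every
ray, but never in two consecutive vertices. -/
theorem IsRayFamily.exists_connector [Finite ι] [Nonempty ι] (hf : G.IsRayFamily f)
    (hl : G.IsEquivalentFamily f) {Z : Set V} (hZ : Z.Finite) :
    ∃ Q : Set V, Q.Finite ∧ Disjoint Z Q ∧ (∀ u ∈ Q, ∀ v ∈ Q, ReachIn G.square.Adj Q u v) ∧
      (∀ c, ∃ i, f c i ∈ Q) ∧ ∀ c i, f c i ∈ Q → f c (i + 1) ∉ Q := by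
  obtain ⟨m, hm⟩ := hf.exists_forall_ge_notMem hZ
  obtain ⟨p, hp⟩ := hf.exists_isAlternateConnected_univ hl hZ m
  set U := offRays f Z ∪ alternate f m Set.univ p with hU
  have hmem : ∀ c i, f c i ∈ U → m ≤ i ∧ Even (i + p c) := by
    rintro c i (h | ⟨d, -, j, hj, hje, h⟩)
    · exact absurd rfl (h.2 c i)
    · obtain ⟨rfl, rfl⟩ := hf.inj h
      exact ⟨hj, hje⟩
  have hex : ∀ c, ∃ i ≥ m, Even (i + p c) := by
    intro c
    rcases Nat.even_or_odd (m + p c) with he | he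
    · exact ⟨m, le_rfl, he⟩
    · exact ⟨m + 1, by omega, by grind⟩
  choose i hi hie using hex
  have halt : ∀ c, f c (i c) ∈ alternate f m Set.univ p := fun c =>
    ⟨c, trivial, i c, hi c, hie c, rfl⟩
  obtain ⟨c₀⟩ := ‹Nonempty ι›
  choose Q hQU hQ hQc hQr using fun c => (hp _ (halt c₀) _ (halt c)).exists_finite
  have hsub : ∀ c, Q c ⊆ ⋃ c, Q c := Set.subset_iUnion Q
  refine ⟨⋃ c, Q c, Set.finite_iUnion hQ, ?_, ?_, fun c => ⟨i c, hsub c (hQc c).right_mem⟩, ?_⟩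
  · refine Set.disjoint_left.mpr fun v hvZ hv => ?_
    obtain ⟨c, hv⟩ := Set.mem_iUnion.mp hv
    rcases hQU c hv with h | ⟨d, -, j, hj, -, rfl⟩
    · exact h.1 hvZ
    · exact hm d j hj hvZ
  · intro u hu v hv
    obtain ⟨c, hu⟩ := Set.mem_iUnion.mp hu
    obtain ⟨d, hv⟩ := Set.mem_iUnion.mp hv
    exact (((hQr c u hu).mono (hsub c)).symm fun _ _ => Adj.symm).trans
      ((hQr d v hv).mono (hsub d))
  · intro c k hk hk'
    have h1 := (hmem c k (Set.iUnion_subset hQU hk)).2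
    have h2 := (hmem c (k + 1) (Set.iUnion_subset hQU hk')).2
    grind

/-- Infinitely many disjoint connectors, whose union still contains no two consecutive vertices of a
ray: each one avoids the earlier ones and their neighbours. -/
theorem IsRayFamily.exists_connectors [Finite ι] [Nonempty ι] [G.LocallyFinite]
    (hf : G.IsRayFamily f) (hl : G.IsEquivalentFamily f) :
    ∃ Q : ℕ → Set V, (∀ n, (∀ u ∈ Q n, ∀ v ∈ Q n, ReachIn G.square.Adj (Q n) u v) ∧
      ∀ c, ∃ i, f c i ∈ Q n) ∧ (∀ m n, m ≠ n → Disjoint (Q m) (Q n)) ∧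
      ∀ c i m n, f c i ∈ Q m → f c (i + 1) ∉ Q n := by
  obtain ⟨Q, hQ, hQQ⟩ := exists_seq_of_forall_finset_exists
    (fun Q : Set V => Q.Finite ∧ (∀ u ∈ Q, ∀ v ∈ Q, ReachIn G.square.Adj Q u v) ∧
      (∀ c, ∃ i, f c i ∈ Q) ∧ ∀ c i, f c i ∈ Q → f c (i + 1) ∉ Q)
    (fun Q Q' => Disjoint (⋃ v ∈ Q, insert v (G.neighborSet v)) Q') (by
      intro s hs
      have hZ : (⋃ Q ∈ s, ⋃ v ∈ Q, insert v (G.neighborSet v)).Finite :=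
        s.finite_toSet.biUnion fun Q hQ => (hs Q hQ).1.biUnion fun v _ =>
          (Set.toFinite (G.neighborSet v)).insert v
      obtain ⟨Q, hQ, hZQ, h⟩ := hf.exists_connector hl hZ
      exact ⟨Q, ⟨hQ, h⟩, fun Q' hQ' => hZQ.mono_left
        (Set.subset_biUnion_of_mem (u := fun Q => ⋃ v ∈ Q, insert v (G.neighborSet v)) hQ')⟩)
  have hne : ∀ m n, m < n → ∀ u ∈ Q m, ∀ v ∈ Q n, v ≠ u ∧ ¬ G.Adj u v := by
    intro m n hmn u hu v hv
    have := fun h => Set.disjoint_right.mp (hQQ m n hmn) hv (Set.mem_biUnion hu h)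
    exact ⟨fun h => this (Or.inl h), fun h => this (Or.inr h)⟩
  refine ⟨Q, fun n => ⟨(hQ n).2.1, (hQ n).2.2.1⟩, fun m n hmn => ?_, fun c i m n hm hn => ?_⟩
  · refine Set.disjoint_left.mpr fun v hm hn => ?_
    rcases hmn.lt_or_gt with h | h
    · exact (hne m n h v hm v hn).1 rfl
    · exact (hne n m h v hn v hm).1 rfl
  · rcases lt_trichotomy m n with h | rfl | h
    · exact (hne m n h _ hm _ hn).2 (hf.adj c i)
    · exact (hQ m).2.2.2 c i hm hn
    · exact (hne n m h _ hn _ hm).2 (hf.adj c i).symm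

/-- A ray stays connected in the square when pairwise non-consecutive vertices are removed. -/
theorem IsRayFamily.reachIn_diff (hf : G.IsRayFamily f) {D B : Set V} {c : ι}
    (hD : ∀ i, f c i ∈ D → f c (i + 1) ∉ D) (hB : ∀ i, f c i ∉ D → f c i ∈ B) {i j : ℕ}
    (hi : f c i ∉ D) (hj : f c j ∉ D) : ReachIn G.square.Adj B (f c i) (f c j) := by
  wlog hij : i ≤ j generalizing i j
  · exact (this hj hi (by omega)).symm fun _ _ => Adj.symm
  obtain ⟨k, rfl⟩ := Nat.exists_eq_add_of_le hij
  clear hij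
  induction k using Nat.strong_induction_on generalizing i with
  | _ k ih =>
    rcases k with _ | k
    · exact refl (hB i hi)
    · by_cases h1 : f c (i + 1) ∈ D
      · rcases k with _ | k
        · exact absurd h1 hj
        · have := ih k (by omega) (hD _ h1) (by rwa [show i + 2 + k = i + (k + 2) by ring])
          rw [show i + 1 + 1 + k = i + (k + 1 + 1) by ring] at this
          exact head (hB i hi) (hf.square_adj c i) this
      · have := ih k (by omega) h1 (by rwa [show i + 1 + k = i + (k + 1) by ring])
        rw [show i + 1 + k = i + (k + 1) by ring] at this
        exact head (hB i hi) (square_adj_of_adj (hf.adj c i)) this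

theorem connected_induce_of_reachIn {B : Set V} {a : V} (ha : a ∈ B)
    (h : ∀ v ∈ B, ReachIn G.Adj B a v) : (G.induce B).Connected := by
  rw [connected_iff_exists_forall_reachable]
  refine ⟨⟨a, ha⟩, fun ⟨v, hv⟩ => ?_⟩
  have key : ∃ hv : v ∈ B, (G.induce B).Reachable ⟨a, ha⟩ ⟨v, hv⟩ := by
    refine (h v hv).tail_induction ⟨ha, .rfl⟩ ?_
    rintro u w - huw hw ⟨hu, hau⟩
    exact ⟨hw, hau.trans (Adj.reachable (G := G.induce B) (u := ⟨u, hu⟩) (v := ⟨w, hw⟩) huw)⟩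
  exact key.2

/-- The branch set of a vertex `x` of `H` is the union of the ray `f x`, from which all connectors
are removed, and a connector of its own, which touches all the other rays. -/
theorem IsRayFamily.isMinor_square [G.LocallyFinite] {W : Type*} [Finite W] {f : W → ℕ → V}
    (hf : G.IsRayFamily f) (hl : G.IsEquivalentFamily f) (H : SimpleGraph W) :
    H.IsMinor G.square := by
  cases isEmpty_or_nonempty W
  · exact ⟨fun _ => ∅, isEmptyElim, isEmptyElim, isEmptyElim⟩
  obtain ⟨Q, hQ, hQd, hQs⟩ := hf.exists_connectors hl
  obtain ⟨e, he⟩ := Countable.exists_injective_nat W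
  set D : Set V := ⋃ n, Q n with hD
  have hQD : ∀ n, Q n ⊆ D := Set.subset_iUnion Q
  have hDs : ∀ c i, f c i ∈ D → f c (i + 1) ∉ D := by
    intro c i hi hi'
    obtain ⟨m, hm⟩ := Set.mem_iUnion.mp hi
    obtain ⟨n, hn⟩ := Set.mem_iUnion.mp hi'
    exact hQs c i m n hm hn
  have htouch : ∀ n c, ∃ i, f c i ∈ Q n ∧ f c (i + 1) ∉ D := fun n c =>
    ((hQ n).2 c).imp fun i hi => ⟨hi, hDs c i (hQD n hi)⟩
  refine ⟨fun x => Q (e x) ∪ {v | v ∉ D ∧ ∃ i, v = f x i}, fun x => ?_, fun x y hxy => ?_,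
    fun x y hxy => ?_⟩
  · obtain ⟨i, hi, hi'⟩ := htouch (e x) x
    refine connected_induce_of_reachIn (Or.inl hi) ?_
    rintro v (hv | ⟨hvD, j, rfl⟩)
    · exact ((hQ (e x)).1 _ hi v hv).mono Set.subset_union_left
    · exact head (Or.inl hi) (square_adj_of_adj (hf.adj x i))
        (hf.reachIn_diff (hDs x) (fun k hk => Or.inr ⟨hk, k, rfl⟩) hi' hvD)
  · refine Set.disjoint_left.mpr ?_
    rintro v (hv | ⟨hvD, i, rfl⟩) (hv' | ⟨hvD', j, h⟩)
    · exact Set.disjoint_left.mp (hQd _ _ (he.ne hxy)) hv hv'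
    · exact hvD' (hQD _ hv)
    · exact hvD (hQD _ hv')
    · exact hxy (hf.inj h).1
  · obtain ⟨i, hi, hi'⟩ := htouch (e x) y
    exact ⟨_, Or.inl hi, _, Or.inr ⟨hi', i + 1, rfl⟩, square_adj_of_adj (hf.adj y i)⟩

end SimpleGraph

/-! ### Balls -/

namespace SimpleGraph

open Relation Relation.ReachIn Filter

variable {V : Type*} {G : SimpleGraph V}

/-- The closed ball of radius `r` around `s`, defined by recursion on `r`: its vertices are those
reached from `s` by a walk of length at most `r`. -/
def walkBall (G : SimpleGraph V) (s : V) : ℕ → Set V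
  | 0 => {s}
  | r + 1 => walkBall G s r ∪ ⋃ u ∈ walkBall G s r, G.neighborSet u

theorem walkBall_subset_succ (s : V) (r : ℕ) : G.walkBall s r ⊆ G.walkBall s (r + 1) :=
  Set.subset_union_left

theorem walkBall_mono (s : V) : Monotone (G.walkBall s) :=
  monotone_nat_of_le_succ (walkBall_subset_succ s)

theorem mem_walkBall_self (s : V) (r : ℕ) : s ∈ G.walkBall s r :=
  walkBall_mono s (Nat.zero_le r) rfl

theorem mem_walkBall_succ_of_adj {s u v : V} {r : ℕ} (hu : u ∈ G.walkBall s r) (h : G.Adj u v) :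
    v ∈ G.walkBall s (r + 1) :=
  Or.inr (Set.mem_biUnion hu h)

theorem finite_walkBall [G.LocallyFinite] (s : V) (r : ℕ) : (G.walkBall s r).Finite := by
  induction r with
  | zero => exact Set.finite_singleton s
  | succ r ih => exact ih.union (ih.biUnion fun u _ => Set.toFinite _)

theorem map_mem_walkBall (φ : G ≃g G) {s v : V} {r : ℕ} (h : v ∈ G.walkBall s r) :
    φ v ∈ G.walkBall (φ s) r := by
  induction r generalizing v with
  | zero => exact congrArg φ h
  | succ r ih =>
    rcases h with h | h
    · exact Or.inl (ih h)
    · simp only [Set.mem_iUnion] at h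
      obtain ⟨u, hu, huv⟩ := h
      exact mem_walkBall_succ_of_adj (ih hu) (φ.map_adj_iff.mpr huv)

theorem map_mem_walkBall_iff (φ : G ≃g G) {s v : V} {r : ℕ} :
    φ v ∈ G.walkBall (φ s) r ↔ v ∈ G.walkBall s r :=
  ⟨fun h => by simpa using map_mem_walkBall φ.symm h, map_mem_walkBall φ⟩

theorem getVert_mem_walkBall {s v : V} (p : G.Walk s v) (i : ℕ) : p.getVert i ∈ G.walkBall s i := by
  induction i with
  | zero => simp [walkBall]
  | succ i ih =>
    by_cases hi : i < p.length
    · exact mem_walkBall_succ_of_adj ih (p.adj_getVert_succ hi)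
    · rw [p.getVert_of_length_le (i := i + 1) (by omega),
        ← p.getVert_of_length_le (i := i) (by omega)]
      exact Or.inl ih

theorem exists_walk_of_reachIn {T : Set V} {a b : V} (h : ReachIn G.Adj T a b) :
    ∃ p : G.Walk a b, ∀ v ∈ p.support, v ∈ T := by
  refine h.head_induction ⟨.nil, by simpa using h.right_mem⟩ ?_
  rintro u v hu huv - ⟨p, hp⟩
  exact ⟨.cons huv p, by simpa using ⟨hu, hp⟩⟩

/-- A walk that leaves the ball of radius `N` around its start contains a path of length `N`. -/
theorem exists_path_of_reachIn {T : Set V} {a b : V} {N : ℕ} (h : ReachIn G.Adj T a b)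
    (hb : b ∉ G.walkBall a N) :
    ∃ g : ℕ → V, g 0 = a ∧ (∀ i, g i ∈ T) ∧ (∀ i < N, G.Adj (g i) (g (i + 1))) ∧
      Set.InjOn g (Set.Iic N) := by
  classical
  obtain ⟨p, hp⟩ := exists_walk_of_reachIn h
  have hlen : N < p.bypass.length := by
    by_contra hle
    exact hb (walkBall_mono a (not_lt.mp hle) (by
      simpa using getVert_mem_walkBall p.bypass p.bypass.length))
  refine ⟨p.bypass.getVert, by simp, fun i => hp _ (p.support_bypass_subset_support
    (p.bypass.getVert_mem_support i)), fun i hi => p.bypass.adj_getVert_succ (by omega), ?_⟩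
  exact (p.bypass_isPath.getVert_injOn).mono fun i (hi : i ≤ N) => by
    simp only [Set.mem_ofPred_eq]; omega

/-! ### Rays by compactness, and one-endedness -/

/-- Compactness: if `T` contains families of disjoint paths of every finite length that start in a
fixed finite set, then it contains a family of disjoint rays. The rays are the limits of the paths
along an ultrafilter. -/
theorem exists_isRayFamily [G.LocallyFinite] {ι : Type*} {F T : Set V} (hF : F.Finite)
    (h : ∀ N : ℕ, ∃ g : ι → ℕ → V, (∀ c, g c 0 ∈ F) ∧ (∀ c, ∀ i ≤ N, g c i ∈ T) ∧
      (∀ c, ∀ i < N, G.Adj (g c i) (g c (i + 1))) ∧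
      ∀ c d, ∀ i ≤ N, ∀ j ≤ N, g c i = g d j → c = d ∧ i = j) :
    ∃ f : ι → ℕ → V, G.IsRayFamily f ∧ ∀ c i, f c i ∈ T := by
  choose g hg0 hgT hga hgi using h
  have hball : ∀ N c i, i ≤ N → g N c i ∈ ⋃ s ∈ F, G.walkBall s i := by
    intro N c i hi
    refine Set.mem_biUnion (hg0 N c) ?_
    induction i with
    | zero => rfl
    | succ i ih => exact mem_walkBall_succ_of_adj (ih (by omega)) (hga N c i (by omega))
  have hlarge : ∀ i, ∀ᶠ N in (hyperfilter ℕ : Filter ℕ), i ≤ N := fun i =>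
    Nat.hyperfilter_le_atTop (eventually_ge_atTop i)
  have hlim : ∀ c i, ∃ v, ∀ᶠ N in (hyperfilter ℕ : Filter ℕ), g N c i = v := by
    intro c i
    have hfin : (⋃ s ∈ F, G.walkBall s i).Finite := hF.biUnion fun s _ => finite_walkBall s i
    obtain ⟨v, -, hv⟩ := (Ultrafilter.eventually_exists_mem_iff (f := hyperfilter ℕ)
      (P := fun v N => g N c i = v) hfin).mp
        ((hlarge i).mono fun N hN => ⟨_, hball N c i hN, rfl⟩)
    exact ⟨v, hv⟩
  choose f hf using hlim
  refine ⟨f, ⟨?_, ?_⟩, ?_⟩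
  · intro c d i j hij
    obtain ⟨N, h1, h2, h3, h4⟩ :=
      ((hf c i).and ((hf d j).and ((hlarge i).and (hlarge j)))).exists
    exact hgi N c d i h3 j h4 (by rw [h1, h2, hij])
  · intro c i
    obtain ⟨N, h1, h2, h3⟩ := ((hf c i).and ((hf c (i + 1)).and (hlarge (i + 1)))).exists
    have := hga N c i (by omega)
    rwa [h1, h2] at this
  · intro c i
    obtain ⟨N, h1, h2⟩ := ((hf c i).and (hlarge i)).exists
    exact h1 ▸ hgT N c i h2

/-- König's lemma: an infinite component of a locally finite graph contains a ray. -/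
theorem exists_ray_of_infinite [G.LocallyFinite] {T : Set V} {a : V}
    (h : {z | ReachIn G.Adj T a z}.Infinite) : ∃ R : G.Ray, ∀ i, ReachIn G.Adj T a (R.vert i) := by
  obtain ⟨f, hf, hfT⟩ := exists_isRayFamily (G := G) (ι := Unit) (F := {a})
    (T := {z | ReachIn G.Adj T a z}) (Set.finite_singleton a) (by
      intro N
      obtain ⟨z, hz, hzN⟩ := (h.sdiff (finite_walkBall (G := G) a N)).nonempty
      have hz' : ReachIn G.Adj {z | ReachIn G.Adj T a z} a z :=
        hz.tail_induction (refl (refl hz.left_mem)) fun u v hu huv hv ih =>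
          ih.tail huv (hu.tail huv hv)
      obtain ⟨g, h0, hT, ha, hi⟩ := exists_path_of_reachIn hz' hzN
      exact ⟨fun _ => g, fun _ => h0, fun _ i _ => hT i, fun _ => ha,
        fun c d i hi' j hj' hij => ⟨rfl, hi hi' hj' hij⟩⟩)
  exact ⟨⟨f (), fun i j hij => (hf.inj hij).2, hf.adj ()⟩, hfT ()⟩

theorem reachIn_of_reachable_induce {T : Set V} {u v : T} (h : (G.induce T).Reachable u v) :
    ReachIn G.Adj T u v := by
  obtain ⟨p⟩ := h
  induction p with
  | nil => exact refl (Subtype.coe_prop _)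
  | cons huv _ ih => exact head (Subtype.coe_prop _) huv ih

theorem Ray.Equivalent.exists_reachIn {R R' : G.Ray} (h : R.Equivalent R') {S : Set V}
    (hS : S.Finite) (m : ℕ) : ∃ i ≥ m, ∃ j ≥ m, ReachIn G.Adj Sᶜ (R.vert i) (R'.vert j) := by
  obtain ⟨C, hC, hC'⟩ := h S hS
  have key : ∀ R : G.Ray, (Set.range R.vert \ C.supp).Finite → ∃ i ≥ m, R.vert i ∈ C.supp := by
    intro R hR
    have hinf : (Set.Ici m \ R.vert ⁻¹' (Set.range R.vert \ C.supp)).Infinite :=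
      (Set.Ici_infinite m).sdiff (hR.preimage R.injective_vert.injOn)
    obtain ⟨i, hi, hi'⟩ := hinf.nonempty
    exact ⟨i, hi, by_contra fun hC => hi' ⟨⟨i, rfl⟩, hC⟩⟩
  obtain ⟨i, hi, hiS, hiC⟩ := key R hC
  obtain ⟨j, hj, hjS, hjC⟩ := key R' hC'
  exact ⟨i, hi, j, hj, reachIn_of_reachable_induce (ConnectedComponent.exact (hiC.trans hjC.symm))⟩

theorem IsOneEnded.equivalent (h : G.IsOneEnded) (R R' : G.Ray) : R.Equivalent R' := by
  obtain ⟨ω, hω⟩ := h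
  exact Quotient.exact (s := G.raySetoid) ((hω ⟦R⟧).trans (hω ⟦R'⟧).symm)

theorem IsOneEnded.isEquivalentFamily (h : G.IsOneEnded) {ι : Type*} {f : ι → ℕ → V}
    (hf : G.IsRayFamily f) : G.IsEquivalentFamily f := fun _ hZ c d m =>
  (h.equivalent ⟨f c, fun _ _ hij => (hf.inj hij).2, hf.adj c⟩
    ⟨f d, fun _ _ hij => (hf.inj hij).2, hf.adj d⟩).exists_reachIn hZ m

/-- At most one component is infinite after the deletion of a finite set. -/
theorem IsOneEnded.reachIn_of_infinite [G.LocallyFinite] (h : G.IsOneEnded) {S : Set V}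
    (hS : S.Finite) {x y : V} (hx : {z | ReachIn G.Adj Sᶜ x z}.Infinite)
    (hy : {z | ReachIn G.Adj Sᶜ y z}.Infinite) : ReachIn G.Adj Sᶜ x y := by
  obtain ⟨R, hR⟩ := exists_ray_of_infinite hx
  obtain ⟨R', hR'⟩ := exists_ray_of_infinite hy
  obtain ⟨i, -, j, -, hij⟩ := (h.equivalent R R').exists_reachIn hS 0
  exact ((hR i).trans hij).trans ((hR' j).symm fun _ _ => Adj.symm)

/-! ### Connected annuli, uniformly in the centre -/

/-- Around `s`, the annulus between the radii `r` and `ρ` connects any two vertices of its innermost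
layer from which one can leave the ball of radius `ρ` without entering that of radius `r`. -/
def IsConnectedAnnulus (G : SimpleGraph V) (s : V) (r ρ : ℕ) : Prop :=
  ∀ x ∈ G.walkBall s (r + 1) \ G.walkBall s r, ∀ y ∈ G.walkBall s (r + 1) \ G.walkBall s r,
    ∀ x' ∉ G.walkBall s ρ, ∀ y' ∉ G.walkBall s ρ, ReachIn G.Adj (G.walkBall s r)ᶜ x x' →
      ReachIn G.Adj (G.walkBall s r)ᶜ y y' → ReachIn G.Adj (G.walkBall s ρ \ G.walkBall s r) x y

theorem eventually_subset_walkBall {s : V} {Q : Set V} (hQ : Q.Finite)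
    (h : ∀ v ∈ Q, ∃ ρ, v ∈ G.walkBall s ρ) : ∀ᶠ ρ in atTop, Q ⊆ G.walkBall s ρ := by
  refine (eventually_all_finite hQ).mpr fun v hv => ?_
  obtain ⟨ρ, hρ⟩ := h v hv
  exact (eventually_ge_atTop ρ).mono fun ρ' hρ' => walkBall_mono s hρ' hρ

theorem exists_mem_walkBall_of_mem_walkBall {T : Set V} {s a b : V} {r : ℕ}
    (ha : a ∈ G.walkBall s r)
    (h : ReachIn G.Adj T a b) : ∃ ρ, b ∈ G.walkBall s ρ :=
  h.tail_induction ⟨r, ha⟩ fun _ _ _ huv _ ⟨ρ, hρ⟩ => ⟨ρ + 1, mem_walkBall_succ_of_adj hρ huv⟩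

theorem IsOneEnded.eventually_isConnectedAnnulus [G.LocallyFinite] (h : G.IsOneEnded) (s : V)
    (r : ℕ) : ∀ᶠ ρ in atTop, G.IsConnectedAnnulus s r ρ := by
  have hB := finite_walkBall (G := G) s r
  have hD : (G.walkBall s (r + 1) \ G.walkBall s r).Finite :=
    (finite_walkBall s (r + 1)).subset Set.sdiff_subset
  refine (eventually_all_finite hD).mpr fun x hx => (eventually_all_finite hD).mpr fun y hy => ?_
  have hfin : ∀ z ∈ G.walkBall s (r + 1), {w | ReachIn G.Adj (G.walkBall s r)ᶜ z w}.Finite →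
      ∀ᶠ ρ in atTop, ∀ w ∉ G.walkBall s ρ, ¬ ReachIn G.Adj (G.walkBall s r)ᶜ z w := by
    intro z hz hf
    exact (eventually_subset_walkBall hf fun w hw => exists_mem_walkBall_of_mem_walkBall hz hw).mono
      fun ρ hρ w hw hzw => hw (hρ hzw)
  by_cases hxf : {w | ReachIn G.Adj (G.walkBall s r)ᶜ x w}.Finite
  · exact (hfin x hx.1 hxf).mono fun ρ hρ x' hx' _ _ hxx' => absurd hxx' (hρ x' hx')
  by_cases hyf : {w | ReachIn G.Adj (G.walkBall s r)ᶜ y w}.Finite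
  · exact (hfin y hy.1 hyf).mono fun ρ hρ _ _ y' hy' _ hyy' => absurd hyy' (hρ y' hy')
  obtain ⟨Q, hQs, hQ, hxy, hQx⟩ := (h.reachIn_of_infinite hB hxf hyf).exists_finite
  exact (eventually_subset_walkBall hQ fun v hv =>
    exists_mem_walkBall_of_mem_walkBall hx.1 (hQx v hv)).mono fun ρ hρ _ _ _ _ _ _ =>
      hxy.mono fun v hv => ⟨hρ hv, hQs hv⟩

theorem map_reachIn (φ : G ≃g G) {T T' : Set V} {a b : V} (hT : ∀ v ∈ T, φ v ∈ T')
    (h : ReachIn G.Adj T a b) : ReachIn G.Adj T' (φ a) (φ b) :=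
  h.tail_induction (refl (hT _ h.left_mem)) fun _ _ _ huv hv ih =>
    ih.tail (φ.map_adj_iff.mpr huv) (hT _ hv)

theorem IsConnectedAnnulus.map {s : V} {r ρ : ℕ} (φ : G ≃g G)
    (h : G.IsConnectedAnnulus (φ s) r ρ) : G.IsConnectedAnnulus s r ρ := by
  have hb : ∀ {v k}, v ∈ G.walkBall s k ↔ φ v ∈ G.walkBall (φ s) k := (map_mem_walkBall_iff φ).symm
  intro x hx y hy x' hx' y' hy' hxx' hyy'
  have hc : ∀ v ∈ (G.walkBall s r)ᶜ, φ v ∈ (G.walkBall (φ s) r)ᶜ := fun v hv hv' => hv (hb.mpr hv')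
  have := h (φ x) ⟨hb.mp hx.1, fun h => hx.2 (hb.mpr h)⟩ (φ y)
    ⟨hb.mp hy.1, fun h => hy.2 (hb.mpr h)⟩ (φ x') (fun h => hx' (hb.mpr h)) (φ y')
    (fun h => hy' (hb.mpr h)) (map_reachIn φ hc hxx') (map_reachIn φ hc hyy')
  simpa using map_reachIn (T' := G.walkBall s ρ \ G.walkBall s r) φ.symm (fun v hv =>
    ⟨hb.mpr (by simpa using hv.1), fun h => hv.2 (by simpa using hb.mp h)⟩) this

theorem IsQuasiTransitive.exists_finite_representatives (h : G.IsQuasiTransitive) :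
    ∃ D : Set V, D.Finite ∧ ∀ s, ∃ φ : G ≃g G, φ s ∈ D := by
  have : Finite (MulAction.orbitRel.Quotient (G ≃g G) V) := h
  refine ⟨Set.range (Quotient.out : MulAction.orbitRel.Quotient (G ≃g G) V → V),
    Set.finite_range _, fun s => ?_⟩
  have : (Quotient.mk'' s : MulAction.orbitRel.Quotient (G ≃g G) V).out ∈
      MulAction.orbit (G ≃g G) s := by
    rw [← MulAction.orbitRel_apply]
    exact Quotient.mk_out (s := MulAction.orbitRel (G ≃g G) V) s
  obtain ⟨φ, hφ⟩ := this
  exact ⟨φ, _, hφ.symm⟩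

theorem IsQuasiTransitive.eventually_isConnectedAnnulus [G.LocallyFinite]
    (hqt : G.IsQuasiTransitive) (h : G.IsOneEnded) (r : ℕ) :
    ∀ᶠ ρ in atTop, ∀ s, G.IsConnectedAnnulus s r ρ := by
  obtain ⟨D, hD, hrep⟩ := hqt.exists_finite_representatives
  refine ((eventually_all_finite hD).mpr
    fun s _ => h.eventually_isConnectedAnnulus s r).mono fun ρ hρ s => ?_
  obtain ⟨φ, hφ⟩ := hrep s
  exact (hρ _ hφ).map φ

theorem IsQuasiTransitive.exists_ncard_walkBall_le [G.LocallyFinite] (hqt : G.IsQuasiTransitive)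
    (r : ℕ) : ∃ b, ∀ s, (G.walkBall s r).ncard ≤ b := by
  obtain ⟨D, hD, hrep⟩ := hqt.exists_finite_representatives
  obtain ⟨b, hb⟩ := (hD.image fun s => (G.walkBall s r).ncard).bddAbove
  refine ⟨b, fun s => ?_⟩
  obtain ⟨φ, hφ⟩ := hrep s
  refine le_trans ?_ (hb ⟨_, hφ, rfl⟩)
  exact Set.ncard_le_ncard_of_injOn φ (fun v => map_mem_walkBall φ) φ.injective.injOn
    (finite_walkBall _ _)

end SimpleGraph

/-! ### Thickness of the end -/

namespace SimpleGraph

open Relation Relation.ReachIn Filter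

variable {V : Type*} {G : SimpleGraph V}

/-- Radii `1 = r 0 < r 1 < …` such that, around every vertex, all annuli between consecutive radii
are connected. -/
theorem IsQuasiTransitive.exists_radii [G.LocallyFinite] (hqt : G.IsQuasiTransitive)
    (h : G.IsOneEnded) :
    ∃ r : ℕ → ℕ, StrictMono r ∧ r 0 = 1 ∧ ∀ j s, G.IsConnectedAnnulus s (r j) (r (j + 1)) := by
  have key : ∀ r, ∃ ρ > r, ∀ s, G.IsConnectedAnnulus s r ρ := fun r =>
    ((eventually_gt_atTop r).and (hqt.eventually_isConnectedAnnulus h r)).exists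
  choose ρ hρ hann using key
  exact ⟨fun j => ρ^[j] 1, strictMono_nat_of_lt_succ fun j => by
    rw [Function.iterate_succ_apply']; exact hρ _, rfl, fun j s => by
    dsimp only
    rw [Function.iterate_succ_apply']; exact hann _ s⟩

/-- Fewer than `n` vertices miss one of `n` consecutive annuli. -/
theorem exists_disjoint_annulus {r : ℕ → ℕ} (hr : StrictMono r) {n : ℕ} {S : Finset V}
    (hS : S.card < n) (s : V) :
    ∃ j < n, ∀ t ∈ S, t ∈ G.walkBall s (r (j + 1)) → t ∈ G.walkBall s (r j) := by
  by_contra! hcon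
  have : Nonempty V := ⟨s⟩
  choose! t htS ht ht' using hcon
  have hinj : Set.InjOn t (Finset.range n : Set ℕ) := by
    intro i hi j hj hij
    simp only [Finset.coe_range, Set.mem_Iio] at hi hj
    by_contra hne
    rcases Nat.lt_or_gt_of_ne hne with h | h
    · exact ht' j hj (walkBall_mono s (hr.monotone h) (hij ▸ ht i hi))
    · exact ht' i hi (walkBall_mono s (hr.monotone h) (hij ▸ ht j hj))
  have := Finset.card_le_card_of_injOn t (fun j hj => htS j (by simpa using hj)) hinj
  simp only [Finset.card_range] at this
  omega

/-- A vertex far from every element of a small finite set `S` lies in an infinite component of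
`G - S`.

Otherwise let `K` be its component and `L` an infinite component of `G - K`. Some vertex `s` of `L`
is adjacent to `K`, hence lies in `S`. An annulus around `s` that is disjoint from `S` is crossed
both by `K` and by `L`, and it connects them within `G - S`. -/
theorem infinite_of_far [G.LocallyFinite] {r : ℕ → ℕ} (hr : StrictMono r) (hr0 : r 0 = 1)
    (hann : ∀ j s, G.IsConnectedAnnulus s (r j) (r (j + 1))) {n : ℕ} {S : Finset V}
    (hS : S.card < n) {u : V} (hu : ∀ s ∈ S, u ∉ G.walkBall s (r n))
    (R : G.Ray) (hR : ReachIn G.Adj Set.univ u (R.vert 0)) :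
    {z | ReachIn G.Adj (S : Set V)ᶜ u z}.Infinite := by
  have hadj : ∀ u v, G.Adj u v → G.Adj v u := fun _ _ => Adj.symm
  intro hK
  set K : Set V := {z | ReachIn G.Adj (S : Set V)ᶜ u z} with hKdef
  have huS : u ∉ S := fun h => hu u h (mem_walkBall_self u _)
  have huK : u ∈ K := refl huS
  obtain ⟨m, hm⟩ := (hK.preimage R.injective_vert.injOn).bddAbove
  have hmK : ∀ i, R.vert (m + 1 + i) ∉ K := fun i hi => by
    have := hm (show m + 1 + i ∈ R.vert ⁻¹' K from hi)
    omega
  set L : Set V := {z | ReachIn G.Adj Kᶜ (R.vert (m + 1)) z} with hLdef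
  have hvL : R.vert (m + 1) ∈ L := refl (hmK 0)
  have hL : L.Infinite := by
    refine (Set.infinite_range_of_injective (f := fun i => R.vert (m + 1 + i)) fun i j hij => by
      have := R.injective_vert hij
      omega).mono ?_
    rintro _ ⟨i, rfl⟩
    induction i with
    | zero => exact hvL
    | succ i ih => exact ReachIn.tail ih (R.adj_succ _) (hmK (i + 1))
  have huv : ReachIn G.Adj Set.univ u (R.vert (m + 1)) := by
    have : ∀ i, ReachIn G.Adj Set.univ u (R.vert i) := fun i => by
      induction i with
      | zero => exact hR
      | succ i ih => exact ih.tail (R.adj_succ i) trivial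
    exact this _
  obtain ⟨a, s, -, haL, has, hs⟩ := huv.exists_last_exit (S := Lᶜ) (fun h => h.right_mem huK)
    (fun h => h hvL)
  have hsL : s ∈ L := not_not.mp hs.left_mem.2
  have hsK : s ∉ K := hsL.right_mem
  have haK : a ∈ K := by_contra fun haK => haL (ReachIn.tail hsL has.symm haK)
  have hsS : s ∈ S := by_contra fun hsS => hsK (ReachIn.tail haK has hsS)
  obtain ⟨j, hj, hjS⟩ := exists_disjoint_annulus (G := G) hr hS s
  have hle : ∀ v, v ∈ G.walkBall s (r (j + 1)) → v ∈ G.walkBall s (r n) := fun v =>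
    fun h => walkBall_mono s (hr.monotone hj) h
  have hlt : ∀ v, v ∈ G.walkBall s (r j) → v ∈ G.walkBall s (r (j + 1)) := fun v =>
    fun h => walkBall_mono s (hr.monotone j.le_succ) h
  have haB : a ∈ G.walkBall s (r j) :=
    walkBall_mono s (hr0.symm.trans_le (hr.monotone j.zero_le))
      (mem_walkBall_succ_of_adj (mem_walkBall_self s 0) has.symm)
  have hau : ReachIn G.Adj (S : Set V)ᶜ a u := ReachIn.symm hadj haK
  obtain ⟨x', x, -, hx', hxx', hxu⟩ := hau.exists_last_exit haB
    (fun h => hu s hsS (hle u (hlt u h)))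
  obtain ⟨w, hwL, hwB⟩ := (hL.sdiff (finite_walkBall (G := G) s (r (j + 1)))).nonempty
  have hsw : ReachIn G.Adj Kᶜ s w := ReachIn.trans (ReachIn.symm hadj hsL) hwL
  obtain ⟨y', y, -, hy', hyy', hyw⟩ := hsw.exists_last_exit (mem_walkBall_self s (r j))
    (fun h => hwB (hlt w h))
  have hxy := hann j s x ⟨mem_walkBall_succ_of_adj hx' hxx', hxu.left_mem.2⟩
    y ⟨mem_walkBall_succ_of_adj hy' hyy', hyw.left_mem.2⟩ u (fun h => hu s hsS (hle u h)) w hwB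
    (hxu.mono fun v hv => hv.2) (hyw.mono fun v hv => hv.2)
  have hxy' : ReachIn G.Adj (S : Set V)ᶜ x y :=
    hxy.mono fun v hv hvS => hv.2 (hjS v hvS hv.1)
  have hxK : ReachIn G.Adj (S : Set V)ᶜ u x :=
    (hxu.mono fun v hv => hv.1).symm hadj
  exact hyw.left_mem.1 (hxK.trans hxy')

/-- Bounded separators cannot cut off arbitrarily large finite sets from the end: the finite set `F`
is so large that some vertex of it is far from every element of a given set `S` of fewer than `n`
vertices. -/
theorem IsQuasiTransitive.exists_finite_forall_infinite [G.LocallyFinite]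
    (hqt : G.IsQuasiTransitive) (h : G.IsOneEnded) (n : ℕ) :
    ∃ F : Finset V, ∀ S : Finset V, S.card < n →
      ∃ u ∈ F, {z | ReachIn G.Adj (S : Set V)ᶜ u z}.Infinite := by
  classical
  obtain ⟨r, hr, hr0, hann⟩ := hqt.exists_radii h
  obtain ⟨b, hb⟩ := hqt.exists_ncard_walkBall_le (r n)
  obtain ⟨R⟩ : Nonempty G.Ray := by
    obtain ⟨ω, -⟩ := h
    exact ⟨ω.out⟩
  refine ⟨(Finset.range (n * b + 1)).image R.vert, fun S hS => ?_⟩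
  have hcard : (⋃ s ∈ S, G.walkBall s (r n)).ncard <
      ((Finset.range (n * b + 1)).image R.vert).card := by
    rw [Finset.card_image_of_injective _ R.injective_vert, Finset.card_range]
    calc (⋃ s ∈ S, G.walkBall s (r n)).ncard ≤ ∑ s ∈ S, (G.walkBall s (r n)).ncard :=
          Finset.set_ncard_biUnion_le S _
      _ ≤ ∑ s ∈ S, b := Finset.sum_le_sum fun s _ => hb s
      _ = S.card * b := by simp
      _ ≤ n * b := Nat.mul_le_mul_right b hS.le
      _ < n * b + 1 := Nat.lt_succ_self _
  obtain ⟨u, huF, hu⟩ : ∃ u ∈ (Finset.range (n * b + 1)).image R.vert,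
      u ∉ ⋃ s ∈ S, G.walkBall s (r n) := by
    by_contra! hcon
    have hfin : (⋃ s ∈ S, G.walkBall s (r n)).Finite :=
      S.finite_toSet.biUnion fun s _ => finite_walkBall s _
    have := Set.ncard_le_ncard (s := ((Finset.range (n * b + 1)).image R.vert : Set V)) hcon hfin
    rw [Set.ncard_coe_finset] at this
    omega
  refine ⟨u, huF, infinite_of_far hr hr0 hann hS (fun s hs hus => hu (Set.mem_biUnion hs hus)) R ?_⟩
  obtain ⟨i, -, rfl⟩ := Finset.mem_image.mp huF
  clear hu huF
  induction i with
  | zero => exact refl trivial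
  | succ i ih => exact head trivial (R.adj_succ i).symm ih

/-- The end is thick: it contains arbitrarily many disjoint rays. Menger's theorem is applied to the
finite balls around `F`. -/
theorem IsQuasiTransitive.exists_isRayFamily [G.LocallyFinite] (hqt : G.IsQuasiTransitive)
    (h : G.IsOneEnded) (n : ℕ) : ∃ f : Fin n → ℕ → V, G.IsRayFamily f := by
  classical
  obtain ⟨F, hF⟩ := hqt.exists_finite_forall_infinite h n
  suffices ∃ f : Fin n → ℕ → V, G.IsRayFamily f ∧ ∀ c i, f c i ∈ Set.univ from
    this.imp fun _ => And.left
  refine SimpleGraph.exists_isRayFamily F.finite_toSet fun N => ?_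
  set C : ℕ → Set V := fun k => ⋃ s ∈ F, G.walkBall s k with hC
  have hCfin : ∀ k, (C k).Finite := fun k => F.finite_toSet.biUnion fun s _ => finite_walkBall s k
  have hFC : ∀ s ∈ F, s ∈ C N := fun s hs => Set.mem_biUnion hs (mem_walkBall_self s N)
  have hCsucc : C N ⊆ C (N + 1) := Set.biUnion_mono subset_rfl fun s _ => walkBall_subset_succ s N
  have hCadj : ∀ u v, u ∈ C N → G.Adj u v → v ∈ C (N + 1) := by
    intro u v hu huv
    simp only [hC, Set.mem_iUnion] at hu ⊢
    obtain ⟨s, hs, hu⟩ := hu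
    exact ⟨s, hs, mem_walkBall_succ_of_adj hu huv⟩
  set E : Finset (V × V) := ((hCfin (N + 1)).toFinset ×ˢ (hCfin (N + 1)).toFinset).filter
    fun e => G.Adj e.1 e.2 with hE
  have hmemE : ∀ u v, (u, v) ∈ E ↔ (u ∈ C (N + 1) ∧ v ∈ C (N + 1)) ∧ G.Adj u v := by
    simp [hE]
  obtain ⟨P, hP, hPab⟩ := menger E n F (C N)ᶜ (by
    intro S hS
    by_contra! hlt
    obtain ⟨u, hu, hinf⟩ := hF S hlt
    obtain ⟨z, hz, hzC⟩ := (hinf.sdiff (hCfin N)).nonempty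
    obtain ⟨x, y, hux, hxy, hyS, hyC⟩ := ReachIn.exists_first_exit hz (hFC u hu) hzC
    refine hS u hu y hyC (ReachIn.tail (b := x) ?_ ((hmemE _ _).mpr
      ⟨⟨hCsucc hux.right_mem.2, hCadj x y hux.right_mem.2 hxy⟩, hxy⟩) hyS)
    refine hux.tail_induction (refl hux.left_mem.1) fun v w hv hvw hw ih => ?_
    exact ih.tail ((hmemE _ _).mpr ⟨⟨hCsucc hv.right_mem.2, hCsucc hw.2⟩, hvw⟩) hw.1)
  have key : ∀ c, ∃ g : ℕ → V, g 0 ∈ F ∧ (∀ i, g i ∈ P c) ∧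
      (∀ i < N, G.Adj (g i) (g (i + 1))) ∧ Set.InjOn g (Set.Iic N) := by
    intro c
    obtain ⟨a, ha, b, hb, hab⟩ := hPab c
    obtain ⟨g, h0, hg⟩ := exists_path_of_reachIn (G := G) (N := N)
      (hab.mono_rel (fun u v huv => ((hmemE u v).mp huv).2) subset_rfl)
      (fun h => hb (Set.mem_biUnion ha h))
    exact ⟨g, h0 ▸ ha, hg⟩
  choose g h0 hgP hga hgi using key
  refine ⟨g, h0, fun _ _ _ => trivial, hga, fun c d i hi j hj hij => ?_⟩
  obtain rfl : c = d := by
    by_contra hne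
    exact Set.disjoint_left.mp (hP c d hne) (hgP c i) (hij ▸ hgP d j)
  exact ⟨rfl, hgi c hi hj hij⟩

end SimpleGraph

theorem mainTheorem3 {V : Type*} (G : SimpleGraph V) [G.LocallyFinite]
    (hqt : G.IsQuasiTransitive) (hend : G.IsOneEnded) :
    ¬ G.square.IsMinorExcluded := by
  rintro ⟨W, hW, H, hH⟩
  obtain ⟨f, hf⟩ := hqt.exists_isRayFamily hend (Nat.card W)
  have hf' : G.IsRayFamily fun x => f (Finite.equivFin W x) :=
    ⟨fun h => ⟨(Finite.equivFin W).injective (hf.inj h).1, (hf.inj h).2⟩, fun x => hf.adj _⟩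
  exact hH (hf'.isMinor_square (hend.isEquivalentFamily hf') H)
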